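/- Let $\phi:[0,1]\to\mathbb{R}$ be continuous on $[0,1]$ and twice continuously differentiable on $(0,1)$, let $\alpha\in[3/2,2]$, and suppose that the second divergence speed of $\phi$ is $p^\alpha$, i.e. there are constants $W>0$, $c_2\ge 0$, $c_2'\ge 0$ with $$W p^{\alpha-2}-c_2'\le |\phi''(p)|\le W p^{\alpha-2}+c_2\qquad\text{for all }p\in(0,1).$$ For integers $n,k\ge1$ let $\mathcal M_k$ be the set of probability vectors $P=(p_1,\dots,p_k)$, let $\theta(P)=\sum_{i=1}^k\phi(p_i)$, let $N=(N_1,\dots,N_k)$ be the histogram of $n$ i.i.d. samples from $P$ (so $N\sim\mathrm{Mult}(n,P)$), and let $$R^*(n,k;\phi)=\inf_{\hat\theta}\ \sup_{P\in\mathcal M_k}\mathbb{E}\big[(\hat\theta(N)-\theta(P))^2\big],$$ the infimum being over all real-valued functions $\hat\theta$ of the histogram. Then $R^*(n,k;\phi)\asymp 1/n$, and the plugin estimator attains this rate. Precisely, there are constants $c,C>0$, depending only on $\phi$ and $\alpha$, such that for all $n,k\ge 1$ $$R^*(n,k;\phi)\le \frac Cn\qquad\text{and}\qquad \sup_{P\in\mathcal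 M_k}\mathbb{E}\Big[\Big(\sum_{i=1}^k\phi(N_i/n)-\theta(P)\Big)^2\Big]\le\frac Cn ,$$ and, for all $n\ge1$ and all $k\ge1$ for which $\theta$ is not constant on $\mathcal M_k$, $$R^*(n,k;\phi)\ge \frac cn .$$ (If $\theta$ is constant on $\mathcal M_k$, then trivially $R^*(n,k;\phi)=0$.) Moreover, $\theta$ is not constant on $\mathcal M_k$ for every $k\ge2$ if $\alpha<2$, and for every $k\ge3$ if $\phi$ is not affine on $[0,1]$. -/

import Mathlib

open scoped BigOperators ENNReal

noncomputable section

/-- The `ℓ`th divergence speed of `φ` is `p ^ α`: `φ` is `ℓ` times continuously differentiable on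
the open interval `(0, 1)`, and there are `W > 0`, `c ≥ 0`, `c' ≥ 0` such that
`W p^(α - ℓ) - c' ≤ |φ^(ℓ)(p)| ≤ W p^(α - ℓ) + c` for all `p ∈ (0, 1)`.
Only the values of `φ` in `(0, 1)` matter. -/
def HasDivergenceSpeed (ℓ : ℕ) (α : ℝ) (φ : ℝ → ℝ) : Prop :=
  ContDiffOn ℝ ℓ φ (Set.Ioo 0 1) ∧
    ∃ W c c' : ℝ, 0 < W ∧ 0 ≤ c ∧ 0 ≤ c' ∧ ∀ p ∈ Set.Ioo (0 : ℝ) 1,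
      W * p ^ (-(ℓ : ℝ) + α) - c' ≤ |iteratedDeriv ℓ φ p| ∧
        |iteratedDeriv ℓ φ p| ≤ W * p ^ (-(ℓ : ℝ) + α) + c

/-- The additive functional `θ(P; φ) = ∑ i, φ (p i)`. Probability vectors on an alphabet of size `k`
are the elements of `stdSimplex ℝ (Fin k)`. -/
def additiveFunctional {k : ℕ} (φ : ℝ → ℝ) (P : Fin k → ℝ) : ℝ :=
  ∑ i, φ (P i)

/-- The histogram of a sample: `N i` is the number of `j` with `X j = i`. -/
def histogram {n k : ℕ} (x : Fin n → Fin k) : Fin k → ℕ :=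
  fun i => (Finset.univ.filter fun j => x j = i).card

/-- The expectation of `f (X 1, …, X n)` for i.i.d. samples `X j` with law `P`. -/
def iidExpectation {n k : ℕ} (P : Fin k → ℝ) (f : (Fin n → Fin k) → ℝ) : ℝ :=
  ∑ x : Fin n → Fin k, (∏ j, P (x j)) * f x

/-- The quadratic risk `E (est N - θ(P; φ))²`, where `N` is the histogram of `n` i.i.d. samples
from `P`, that is, multinomial with parameters `n` and `P`. -/
def quadraticRisk (n : ℕ) {k : ℕ} (φ : ℝ → ℝ) (est : (Fin k → ℕ) → ℝ) (P : Fin k → ℝ) : ℝ :=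
  iidExpectation P fun x : Fin n → Fin k =>
    (est (histogram x) - additiveFunctional φ P) ^ 2

/-- The supremum of the quadratic risk of an estimator over all probability vectors. -/
def worstCaseRisk (n k : ℕ) (φ : ℝ → ℝ) (est : (Fin k → ℕ) → ℝ) : ℝ≥0∞ :=
  ⨆ P ∈ stdSimplex ℝ (Fin k), ENNReal.ofReal (quadraticRisk n φ est P)

/-- The minimax risk `R*(n, k; φ)`; the infimum is over all estimators. -/
def minimaxRisk (n k : ℕ) (φ : ℝ → ℝ) : ℝ≥0∞ :=
  ⨅ est : (Fin k → ℕ) → ℝ, worstCaseRisk n k φ est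

/-- The plugin estimator `∑ i, φ (N i / n)`. -/
def pluginEstimator (n : ℕ) {k : ℕ} (φ : ℝ → ℝ) (N : Fin k → ℕ) : ℝ :=
  ∑ i, φ ((N i : ℝ) / n)

/-- The functional `θ(·; φ)` takes at least two values on the probability vectors of size `k`. -/
def FunctionalNonconstant (k : ℕ) (φ : ℝ → ℝ) : Prop :=
  ∃ P ∈ stdSimplex ℝ (Fin k), ∃ Q ∈ stdSimplex ℝ (Fin k),
    additiveFunctional φ P ≠ additiveFunctional φ Q

/-- The restriction of `φ` to `[0, 1]` is an affine function. -/
def AffineOnUnitInterval (φ : ℝ → ℝ) : Prop :=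
  ∃ a b : ℝ, ∀ p ∈ Set.Icc (0 : ℝ) 1, φ p = a + b * p

end

/-! Upper bound: since `α ≥ 3/2`, `|φ''| ≤ A / √p`. This is integrable at 0, so `φ` is Lipschitz;
changing one sample then moves the plugin by `O(1 / n)`, and `iidExpectation_sq_sub_sq_le` bounds
its variance by `O(1 / n)`. For the bias, `±φ + (4/3) A p^(3/2)` are convex, so by Jensen the bias
in cell `i` is controlled by that of `p^(3/2)`, which Cauchy–Schwarz bounds by `p_i / √n`. Because
`∑ p_i = 1`, these add up to `O(1 / √n)` for every alphabet size (`abs_bias_le`).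

Lower bound: only continuity of `φ` is needed. Take a segment, trimmed at both ends, on which `θ`
changes by a nonzero `G`, and cut it into about `√n` equal steps. Neighbouring points have bounded
chi-square affinity after `n` samples, so Le Cam's method bounds each increment of `θ` by a constant
times `√r`, `r` being a bound for the risk. Adding the steps gives `G² = O(n r)`
(`sq_sub_le_of_quadraticRisk_le`). Choosing the segment in the smallest possible alphabet and
padding with zeros makes the constant independent of `k`. -/

section Expectation

/-! ### Expectations under i.i.d. sampling, and moments of the histogram -/

variable {n k : ℕ}

theorem iidExpectation_zero (P : Fin k → ℝ) (f : (Fin 0 → Fin k) → ℝ) :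
    iidExpectation P f = f default := by
  simp [iidExpectation]

theorem iidExpectation_succ (P : Fin k → ℝ) (f : (Fin (n + 1) → Fin k) → ℝ) :
    iidExpectation P f =
      ∑ a, P a * iidExpectation P fun x : Fin n → Fin k => f (Fin.cons a x) := by
  unfold iidExpectation
  rw [← (Fin.consEquiv fun _ => Fin k).sum_comp, Fintype.sum_prod_type]
  refine Finset.sum_congr rfl fun a _ => ?_
  rw [Finset.mul_sum]
  refine Finset.sum_congr rfl fun x _ => ?_
  simp [Fin.consEquiv, Fin.prod_univ_succ, mul_assoc]

theorem iidExpectation_add (P : Fin k → ℝ) (f g : (Fin n → Fin k) → ℝ) :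
    iidExpectation P (fun x => f x + g x) = iidExpectation P f + iidExpectation P g := by
  simp [iidExpectation, mul_add, Finset.sum_add_distrib]

theorem iidExpectation_sub (P : Fin k → ℝ) (f g : (Fin n → Fin k) → ℝ) :
    iidExpectation P (fun x => f x - g x) = iidExpectation P f - iidExpectation P g := by
  simp [iidExpectation, mul_sub, Finset.sum_sub_distrib]

theorem iidExpectation_const_mul (P : Fin k → ℝ) (c : ℝ) (f : (Fin n → Fin k) → ℝ) :
    iidExpectation P (fun x => c * f x) = c * iidExpectation P f := by
  simp only [iidExpectation, Finset.mul_sum]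
  exact Finset.sum_congr rfl fun x _ => by ring

theorem iidExpectation_sum {ι : Type*} (s : Finset ι) (P : Fin k → ℝ)
    (f : ι → (Fin n → Fin k) → ℝ) :
    iidExpectation P (fun x => ∑ i ∈ s, f i x) = ∑ i ∈ s, iidExpectation P (f i) := by
  simp only [iidExpectation, Finset.mul_sum]
  exact Finset.sum_comm

/-- Gives total mass one for `u = P`, and the tensorization of the chi-square affinity for `u = Q² /
P`. -/
theorem sum_prod_eq_pow (u : Fin k → ℝ) :
    ∑ x : Fin n → Fin k, ∏ j, u (x j) = (∑ i, u i) ^ n := by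
  simpa using (Fintype.sum_pow u n).symm

theorem prod_nonneg_of_mem_stdSimplex {P : Fin k → ℝ} (hP : P ∈ stdSimplex ℝ (Fin k))
    (x : Fin n → Fin k) : 0 ≤ ∏ j, P (x j) :=
  Finset.prod_nonneg fun j _ => hP.1 (x j)

theorem sum_prod_eq_one {P : Fin k → ℝ} (hP : P ∈ stdSimplex ℝ (Fin k)) :
    ∑ x : Fin n → Fin k, ∏ j, P (x j) = 1 := by
  rw [sum_prod_eq_pow, hP.2, one_pow]

theorem iidExpectation_const {P : Fin k → ℝ} (hP : P ∈ stdSimplex ℝ (Fin k)) (c : ℝ) :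
    iidExpectation P (fun _ : Fin n → Fin k => c) = c := by
  rw [iidExpectation, ← Finset.sum_mul, sum_prod_eq_one hP, one_mul]

theorem iidExpectation_mono {P : Fin k → ℝ} (hP : P ∈ stdSimplex ℝ (Fin k))
    {f g : (Fin n → Fin k) → ℝ} (h : ∀ x, f x ≤ g x) :
    iidExpectation P f ≤ iidExpectation P g :=
  Finset.sum_le_sum fun x _ => mul_le_mul_of_nonneg_left (h x) (prod_nonneg_of_mem_stdSimplex hP x)

theorem abs_iidExpectation_le {P : Fin k → ℝ} (hP : P ∈ stdSimplex ℝ (Fin k))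
    {f : (Fin n → Fin k) → ℝ} {D : ℝ} (h : ∀ x, |f x| ≤ D) : |iidExpectation P f| ≤ D := by
  rw [abs_le]
  constructor
  · rw [← iidExpectation_const (n := n) hP (-D)]
    exact iidExpectation_mono hP fun x => (abs_le.1 (h x)).1
  · rw [← iidExpectation_const (n := n) hP D]
    exact iidExpectation_mono hP fun x => (abs_le.1 (h x)).2

theorem sq_iidExpectation_mul_le {P : Fin k → ℝ} (hP : P ∈ stdSimplex ℝ (Fin k))
    (f g : (Fin n → Fin k) → ℝ) :
    iidExpectation P (fun x => f x * g x) ^ 2 ≤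
      iidExpectation P (fun x => f x ^ 2) * iidExpectation P (fun x => g x ^ 2) := by
  unfold iidExpectation
  refine Finset.sum_sq_le_sum_mul_sum_of_sq_le_mul _ (fun x _ => ?_) (fun x _ => ?_)
    (fun x _ => le_of_eq (by ring))
  · exact mul_nonneg (prod_nonneg_of_mem_stdSimplex hP x) (sq_nonneg _)
  · exact mul_nonneg (prod_nonneg_of_mem_stdSimplex hP x) (sq_nonneg _)

/-- A form of the Efron–Stein inequality for functions with bounded differences. -/
theorem iidExpectation_sq_sub_sq_le {P : Fin k → ℝ} (hP : P ∈ stdSimplex ℝ (Fin k)) {D : ℝ}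
    (f : (Fin n → Fin k) → ℝ) (hf : ∀ x j a, |f (Function.update x j a) - f x| ≤ D) :
    iidExpectation P (fun x => f x ^ 2) - iidExpectation P f ^ 2 ≤ n * D ^ 2 := by
  induction n with
  | zero => simp [iidExpectation_zero]
  | succ n ih =>
    -- Condition on the first sample: `g` is the conditional mean. The mean conditional variance is
    -- at most `n D²` by induction, and the variance of `g` is at most `D²`.
    set g : Fin k → ℝ := fun a => iidExpectation P fun x : Fin n → Fin k => f (Fin.cons a x) with hg
    set m : ℝ := ∑ a, P a * g a with hm
    have hgD : ∀ a b, |g a - g b| ≤ D := by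
      intro a b
      rw [hg]
      simp only
      rw [← iidExpectation_sub]
      refine abs_iidExpectation_le hP fun x => ?_
      have := hf (Fin.cons b x) 0 a
      rwa [Fin.update_cons_zero] at this
    have hgm : ∀ a, (g a - m) ^ 2 ≤ D ^ 2 := by
      intro a
      have h1 : g a - m = ∑ b, P b * (g a - g b) := by
        simp only [mul_sub, Finset.sum_sub_distrib, ← Finset.sum_mul, hP.2, one_mul, hm]
      have h2 : |g a - m| ≤ D := by
        rw [h1]
        refine (Finset.abs_sum_le_sum_abs _ _).trans ?_
        calc ∑ b, |P b * (g a - g b)| ≤ ∑ b, P b * D := by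
              refine Finset.sum_le_sum fun b _ => ?_
              rw [abs_mul, abs_of_nonneg (hP.1 b)]
              exact mul_le_mul_of_nonneg_left (hgD a b) (hP.1 b)
          _ = D := by rw [← Finset.sum_mul, hP.2, one_mul]
      exact sq_le_sq' (abs_le.1 h2).1 (abs_le.1 h2).2
    have hstep : ∀ a, iidExpectation P (fun x : Fin n → Fin k => f (Fin.cons a x) ^ 2) - g a ^ 2
        ≤ n * D ^ 2 := fun a => ih _ fun x j b => by
      have := hf (Fin.cons a x) j.succ b
      rwa [← Fin.cons_update] at this
    have hvar : ∑ a, P a * g a ^ 2 - m ^ 2 ≤ D ^ 2 := by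
      have h1 : ∑ a, P a * g a ^ 2 - m ^ 2 = ∑ a, P a * (g a - m) ^ 2 := by
        have : ∀ a, P a * (g a - m) ^ 2 = P a * g a ^ 2 - 2 * m * (P a * g a) + m ^ 2 * P a :=
          fun a => by ring
        simp only [this, Finset.sum_add_distrib, Finset.sum_sub_distrib, ← Finset.mul_sum, hP.2,
          ← hm]
        ring
      rw [h1]
      calc ∑ a, P a * (g a - m) ^ 2 ≤ ∑ a, P a * D ^ 2 :=
            Finset.sum_le_sum fun a _ => mul_le_mul_of_nonneg_left (hgm a) (hP.1 a)
        _ = D ^ 2 := by rw [← Finset.sum_mul, hP.2, one_mul]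
    have hsum : ∑ a, P a * iidExpectation P (fun x : Fin n → Fin k => f (Fin.cons a x) ^ 2)
        ≤ ∑ a, P a * g a ^ 2 + n * D ^ 2 := by
      calc _ ≤ ∑ a, P a * (g a ^ 2 + n * D ^ 2) := Finset.sum_le_sum fun a _ =>
            mul_le_mul_of_nonneg_left (by linarith [hstep a]) (hP.1 a)
        _ = _ := by
          simp only [mul_add, Finset.sum_add_distrib]
          rw [← Finset.sum_mul, hP.2, one_mul]
    rw [iidExpectation_succ, iidExpectation_succ]
    push_cast
    change _ - m ^ 2 ≤ _
    linarith

theorem histogram_eq_sum (x : Fin n → Fin k) (i : Fin k) :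
    (histogram x i : ℝ) = ∑ j, if x j = i then 1 else 0 := by
  simp [histogram]

theorem histogram_cons (a : Fin k) (x : Fin n → Fin k) (i : Fin k) :
    (histogram (Fin.cons a x : Fin (n + 1) → Fin k) i : ℝ) =
      (if a = i then 1 else 0) + histogram x i := by
  simp only [histogram_eq_sum, Fin.sum_univ_succ, Fin.cons_zero, Fin.cons_succ]

theorem histogram_le (x : Fin n → Fin k) (i : Fin k) : histogram x i ≤ n := by
  simpa [histogram] using Finset.card_filter_le (Finset.univ : Finset (Fin n)) fun j => x j = i

theorem iidExpectation_histogram {P : Fin k → ℝ} (hP : P ∈ stdSimplex ℝ (Fin k)) (i : Fin k) :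
    iidExpectation P (fun x : Fin n → Fin k => (histogram x i : ℝ)) = n * P i := by
  induction n with
  | zero => simp [iidExpectation_zero, histogram]
  | succ n ih =>
    rw [iidExpectation_succ]
    simp only [histogram_cons, iidExpectation_add, iidExpectation_const hP, ih, mul_add,
      Finset.sum_add_distrib, mul_ite, mul_one, mul_zero, Finset.sum_ite_eq', Finset.mem_univ,
      if_true, ← Finset.sum_mul, hP.2]
    push_cast
    ring

theorem iidExpectation_histogram_sq {P : Fin k → ℝ} (hP : P ∈ stdSimplex ℝ (Fin k))
    (i : Fin k) :
    iidExpectation P (fun x : Fin n → Fin k => (histogram x i : ℝ) ^ 2) =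
      n * P i + n * (n - 1) * P i ^ 2 := by
  induction n with
  | zero => simp [iidExpectation_zero, histogram]
  | succ n ih =>
    rw [iidExpectation_succ]
    have h : ∀ a, iidExpectation P (fun x : Fin n → Fin k =>
        (histogram (Fin.cons a x : Fin (n + 1) → Fin k) i : ℝ) ^ 2) =
        (if a = i then 1 + 2 * (n * P i) else 0) + (n * P i + n * (n - 1) * P i ^ 2) := by
      intro a
      rw [← ih]
      by_cases hai : a = i
      · have : ∀ x : Fin n → Fin k, (histogram (Fin.cons a x : Fin (n + 1) → Fin k) i : ℝ) ^ 2 =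
            1 + 2 * histogram x i + (histogram x i : ℝ) ^ 2 := fun x => by
          rw [histogram_cons, if_pos hai]; ring
        simp only [this, iidExpectation_add, iidExpectation_const_mul, iidExpectation_const hP,
          iidExpectation_histogram hP, if_pos hai]
      · simp [histogram_cons, hai]
    simp only [h, mul_add, Finset.sum_add_distrib, mul_ite, mul_zero,
      Finset.sum_ite_eq', Finset.mem_univ, if_true, ← Finset.sum_mul, hP.2]
    push_cast
    ring

/-- Replacing a sample adds one to one count and removes one from another, whatever the number of
cells. -/
theorem sum_abs_histogram_update_sub_le (x : Fin n → Fin k) (j : Fin n) (a : Fin k) :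
    ∑ i, |(histogram (Function.update x j a) i : ℝ) - histogram x i| ≤ 2 := by
  have h : ∀ i, |(histogram (Function.update x j a) i : ℝ) - histogram x i| ≤
      (if a = i then 1 else 0) + if x j = i then 1 else 0 := by
    intro i
    have : (histogram (Function.update x j a) i : ℝ) - histogram x i =
        (if a = i then 1 else 0) - if x j = i then 1 else 0 := by
      rw [histogram_eq_sum, histogram_eq_sum, ← Finset.sum_sub_distrib,
        Finset.sum_eq_single j]
      · simp
      · intro l _ hl
        simp [Function.update_of_ne hl]
      · simp
    rw [this]
    split_ifs <;> norm_num
  refine (Finset.sum_le_sum fun i _ => h i).trans ?_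
  simp only [Finset.sum_add_distrib, Finset.sum_ite_eq, Finset.mem_univ, if_true]
  norm_num

end Expectation

/-! ### Consequences of `|φ''| ≤ A / √p` -/

section Analysis

theorem hasDerivAt_mul_sqrt {p : ℝ} (hp : 0 < p) :
    HasDerivAt (fun x => x * √x) (3 / 2 * √p) p := by
  refine ((hasDerivAt_id p).mul (Real.hasDerivAt_sqrt hp.ne')).congr_deriv ?_
  have h : √p * √p = p := Real.mul_self_sqrt hp.le
  have : √p ≠ 0 := (Real.sqrt_pos.2 hp).ne'
  simp only [id]
  field_simp
  nlinarith

/-- If `|f''| ≤ A / √p` then `f' + 2 A √p` is monotone. -/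
theorem monotoneOn_deriv_add_sqrt {f₁ f₂ : ℝ → ℝ} {A : ℝ}
    (h : ∀ p ∈ Set.Ioo (0 : ℝ) 1, HasDerivAt f₁ (f₂ p) p)
    (hb : ∀ p ∈ Set.Ioo (0 : ℝ) 1, |f₂ p| ≤ A / √p) :
    MonotoneOn (fun p => f₁ p + 2 * A * √p) (Set.Ioo 0 1) := by
  have hd : ∀ p ∈ Set.Ioo (0 : ℝ) 1,
      HasDerivAt (fun p => f₁ p + 2 * A * √p) (f₂ p + A / √p) p := by
    intro p hp
    refine ((h p hp).add ((Real.hasDerivAt_sqrt hp.1.ne').const_mul (2 * A))).congr_deriv ?_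
    have : √p ≠ 0 := (Real.sqrt_pos.2 hp.1).ne'
    field_simp
  refine monotoneOn_of_deriv_nonneg (convex_Ioo 0 1)
    (fun p hp => (hd p hp).continuousAt.continuousWithinAt) ?_ ?_
  · rw [interior_Ioo]
    exact fun p hp => (hd p hp).differentiableAt.differentiableWithinAt
  · rw [interior_Ioo]
    intro p hp
    rw [(hd p hp).deriv]
    linarith [neg_abs_le (f₂ p), hb p hp]

/-- If `|f''| ≤ A / √p` then `f + (4 / 3) A p ^ (3 / 2)` is convex. -/
theorem convexOn_add_mul_sqrt {f f₁ f₂ : ℝ → ℝ} {A : ℝ} (hf : ContinuousOn f (Set.Icc 0 1))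
    (h₁ : ∀ p ∈ Set.Ioo (0 : ℝ) 1, HasDerivAt f (f₁ p) p)
    (h₂ : ∀ p ∈ Set.Ioo (0 : ℝ) 1, HasDerivAt f₁ (f₂ p) p)
    (hb : ∀ p ∈ Set.Ioo (0 : ℝ) 1, |f₂ p| ≤ A / √p) :
    ConvexOn ℝ (Set.Icc 0 1) (fun p => f p + 4 / 3 * A * (p * √p)) := by
  have hd : ∀ p ∈ Set.Ioo (0 : ℝ) 1,
      HasDerivAt (fun p => f p + 4 / 3 * A * (p * √p)) (f₁ p + 2 * A * √p) p := fun p hp =>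
    ((h₁ p hp).add ((hasDerivAt_mul_sqrt hp.1).const_mul (4 / 3 * A))).congr_deriv (by ring)
  refine MonotoneOn.convexOn_of_deriv (convex_Icc 0 1) ?_ ?_ ?_
  · exact hf.add (Continuous.continuousOn (by fun_prop))
  · rw [interior_Icc]
    exact fun p hp => (hd p hp).differentiableAt.differentiableWithinAt
  · rw [interior_Icc]
    exact (monotoneOn_deriv_add_sqrt h₂ hb).congr fun p hp => (hd p hp).deriv.symm

/-- If `|f''| ≤ A / √p` then `f` is Lipschitz on `[0, 1]`. -/
theorem exists_lipschitz_of_abs_deriv2_le {f f₁ f₂ : ℝ → ℝ} {A : ℝ}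
    (hf : ContinuousOn f (Set.Icc 0 1))
    (h₁ : ∀ p ∈ Set.Ioo (0 : ℝ) 1, HasDerivAt f (f₁ p) p)
    (h₂ : ∀ p ∈ Set.Ioo (0 : ℝ) 1, HasDerivAt f₁ (f₂ p) p)
    (hb : ∀ p ∈ Set.Ioo (0 : ℝ) 1, |f₂ p| ≤ A / √p) :
    ∃ L : ℝ, 0 < L ∧ ∀ x ∈ Set.Icc (0 : ℝ) 1, ∀ y ∈ Set.Icc (0 : ℝ) 1,
      |f x - f y| ≤ L * |x - y| := by
  have hA : 0 ≤ A := by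
    have hm : (1 / 2 : ℝ) ∈ Set.Ioo (0 : ℝ) 1 := by norm_num
    have := (abs_nonneg _).trans (hb _ hm)
    by_contra hneg
    exact absurd this (not_le.2 (div_neg_of_neg_of_pos (not_le.1 hneg) (by positivity)))
  -- `2 A` bounds the integral of `A / √p` over `(0, 1)`. Stated for a general pair so that it
  -- applies to both `f₁` and `-f₁`.
  have key : ∀ g₁ g₂ : ℝ → ℝ, (∀ p ∈ Set.Ioo (0 : ℝ) 1, HasDerivAt g₁ (g₂ p) p) →
      (∀ p ∈ Set.Ioo (0 : ℝ) 1, |g₂ p| ≤ A / √p) → ∀ p ∈ Set.Ioo (0 : ℝ) 1,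
      ∀ q ∈ Set.Ioo (0 : ℝ) 1, p ≤ q → g₁ p ≤ g₁ q + 2 * A := by
    intro g₁ g₂ hg hgb p hp q hq hpq
    have hmono := monotoneOn_deriv_add_sqrt hg hgb hp hq hpq
    simp only at hmono
    have h1 : √q ≤ 1 := Real.sqrt_le_one.2 hq.2.le
    have h0 : 0 ≤ √p := Real.sqrt_nonneg p
    nlinarith
  have key2 : ∀ p ∈ Set.Ioo (0 : ℝ) 1, ∀ q ∈ Set.Ioo (0 : ℝ) 1, p ≤ q →
      |f₁ p - f₁ q| ≤ 2 * A := by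
    intro p hp q hq hpq
    have ha := key f₁ f₂ h₂ hb p hp q hq hpq
    have hc := key (fun x => -f₁ x) (fun x => -f₂ x) (fun x hx => (h₂ x hx).neg)
      (fun x hx => by simpa using hb x hx) p hp q hq hpq
    rw [abs_le]
    constructor <;> linarith
  have hm : (1 / 2 : ℝ) ∈ Set.Ioo (0 : ℝ) 1 := by norm_num
  have hbound : ∀ p ∈ Set.Ioo (0 : ℝ) 1, |f₁ p| ≤ |f₁ (1 / 2)| + 2 * A := by
    intro p hp
    have : |f₁ p - f₁ (1 / 2)| ≤ 2 * A := by
      rcases le_total p (1 / 2) with h | h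
      · exact key2 p hp _ hm h
      · rw [abs_sub_comm]; exact key2 _ hm p hp h
    linarith [abs_sub_abs_le_abs_sub (f₁ p) (f₁ (1 / 2))]
  -- The summand 1 only serves to make the Lipschitz constant positive.
  have hmain : ∀ x ∈ Set.Icc (0 : ℝ) 1, ∀ y ∈ Set.Icc (0 : ℝ) 1, x < y →
      |f x - f y| ≤ (|f₁ (1 / 2)| + 2 * A + 1) * |x - y| := by
    intro x hx y hy hxy
    have hsub : Set.Ioo x y ⊆ Set.Ioo 0 1 := Set.Ioo_subset_Ioo hx.1 hy.2
    obtain ⟨c, hc, hce⟩ := exists_hasDerivAt_eq_slope f f₁ hxy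
      (hf.mono (Set.Icc_subset_Icc hx.1 hy.2)) fun z hz => h₁ z (hsub hz)
    have hpos : 0 < y - x := sub_pos.2 hxy
    have : f y - f x = f₁ c * (y - x) := by rw [hce]; field_simp
    rw [abs_sub_comm, this, abs_mul, abs_sub_comm x y]
    exact mul_le_mul_of_nonneg_right (by linarith [hbound c (hsub hc)]) (abs_nonneg _)
  refine ⟨|f₁ (1 / 2)| + 2 * A + 1, by positivity, fun x hx y hy => ?_⟩
  rcases lt_trichotomy x y with h | h | h
  · exact hmain x hx y hy h
  · simp [h]
  · rw [abs_sub_comm, abs_sub_comm x y]; exact hmain y hy x hx h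

theorem HasDivergenceSpeed.hasDerivAt {α : ℝ} {φ : ℝ → ℝ} (h : HasDivergenceSpeed 2 α φ)
    {p : ℝ} (hp : p ∈ Set.Ioo (0 : ℝ) 1) : HasDerivAt φ (deriv φ p) p :=
  ((h.1.differentiableOn (by norm_num)).differentiableAt
    (isOpen_Ioo.mem_nhds hp)).hasDerivAt

theorem HasDivergenceSpeed.hasDerivAt_deriv {α : ℝ} {φ : ℝ → ℝ} (h : HasDivergenceSpeed 2 α φ)
    {p : ℝ} (hp : p ∈ Set.Ioo (0 : ℝ) 1) : HasDerivAt (deriv φ) (iteratedDeriv 2 φ p) p := by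
  have h2 : ContDiffOn ℝ (1 + 1) φ (Set.Ioo 0 1) := by simpa [one_add_one_eq_two] using h.1
  have h1 := ((contDiffOn_succ_iff_deriv_of_isOpen isOpen_Ioo).1 h2).2.2
  rw [iteratedDeriv_succ, iteratedDeriv_one]
  exact ((h1.differentiableOn (by norm_num)).differentiableAt
    (isOpen_Ioo.mem_nhds hp)).hasDerivAt

/-- On `(0, 1)`, `α - 2 ≥ -1/2` gives `p^(α - 2) ≤ 1 / √p`, and `1 ≤ 1 / √p` absorbs the additive
constant. This is where `α ≥ 3/2` enters. -/
theorem HasDivergenceSpeed.exists_abs_le {α : ℝ} {φ : ℝ → ℝ} (h : HasDivergenceSpeed 2 α φ)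
    (hα : 3 / 2 ≤ α) :
    ∃ A : ℝ, 0 < A ∧ ∀ p ∈ Set.Ioo (0 : ℝ) 1, |iteratedDeriv 2 φ p| ≤ A / √p := by
  obtain ⟨-, W, c, c', hW, hc, -, hb⟩ := h
  refine ⟨W + c, by positivity, fun p hp => (hb p hp).2.trans ?_⟩
  have hs : 0 < √p := Real.sqrt_pos.2 hp.1
  have h1 : p ^ (-((2 : ℕ) : ℝ) + α) ≤ 1 / √p := by
    have : (1 : ℝ) / √p = p ^ (-(1 / 2) : ℝ) := by
      rw [Real.rpow_neg hp.1.le, Real.sqrt_eq_rpow, one_div]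
    rw [this]
    exact Real.rpow_le_rpow_of_exponent_ge hp.1 hp.2.le (by push_cast; linarith)
  have h2 : (1 : ℝ) ≤ 1 / √p := by
    rw [le_div_iff₀ hs, one_mul]
    exact Real.sqrt_le_one.2 hp.2.le
  calc W * p ^ (-((2 : ℕ) : ℝ) + α) + c ≤ W * (1 / √p) + c * (1 / √p) := by
        gcongr
        nlinarith
    _ = (W + c) / √p := by ring

end Analysis

/-! ### Variance and bias of the plugin estimator -/

section UpperBound

variable {n k : ℕ}

theorem histogram_div_mem (x : Fin n → Fin k) (i : Fin k) :
    (histogram x i : ℝ) / n ∈ Set.Icc (0 : ℝ) 1 :=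
  ⟨by positivity, div_le_one_of_le₀ (by exact_mod_cast histogram_le x i) (by positivity)⟩

theorem iidExpectation_frequency (hn : 1 ≤ n) {P : Fin k → ℝ} (hP : P ∈ stdSimplex ℝ (Fin k))
    (i : Fin k) :
    iidExpectation P (fun x : Fin n → Fin k => (histogram x i : ℝ) / n) = P i := by
  have hn' : (n : ℝ) ≠ 0 := by positivity
  simp only [div_eq_inv_mul, iidExpectation_const_mul, iidExpectation_histogram hP]
  field_simp

theorem ConvexOn.le_iidExpectation_frequency {f : ℝ → ℝ} (hf : ConvexOn ℝ (Set.Icc 0 1) f)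
    (hn : 1 ≤ n) {P : Fin k → ℝ} (hP : P ∈ stdSimplex ℝ (Fin k)) (i : Fin k) :
    f (P i) ≤ iidExpectation P (fun x : Fin n → Fin k => f ((histogram x i : ℝ) / n)) := by
  have := hf.map_sum_le (t := Finset.univ) (w := fun x : Fin n → Fin k => ∏ j, P (x j))
    (p := fun x => (histogram x i : ℝ) / n)
    (fun x _ => prod_nonneg_of_mem_stdSimplex hP x) (sum_prod_eq_one hP)
    (fun x _ => histogram_div_mem x i)
  simp only [smul_eq_mul] at this
  rwa [show ∑ x : Fin n → Fin k, (∏ j, P (x j)) * ((histogram x i : ℝ) / n) = P i from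
    iidExpectation_frequency hn hP i] at this

/-- With `X` the frequency and `p = P i`, Cauchy–Schwarz for `√X · X` gives `(E X^(3/2))² ≤ E X · E
X² ≤ p² (p + 1/n)`, and `√(p + 1/n) ≤ √p + 1/√n`. The factor `p` in the error is what makes its sum
over the cells independent of `k`. -/
theorem iidExpectation_mul_sqrt_le (hn : 1 ≤ n) {P : Fin k → ℝ}
    (hP : P ∈ stdSimplex ℝ (Fin k)) (i : Fin k) :
    iidExpectation P (fun x : Fin n → Fin k =>
      (histogram x i : ℝ) / n * √((histogram x i : ℝ) / n)) ≤ P i * √(P i) + P i / √n := by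
  have hn0 : (0 : ℝ) < n := by exact_mod_cast hn
  have hp := mem_Icc_of_mem_stdSimplex hP i
  have hs : 0 < √(n : ℝ) := Real.sqrt_pos.2 hn0
  have h2 : iidExpectation P (fun x : Fin n → Fin k => ((histogram x i : ℝ) / n) ^ 2) ≤
      P i * (P i + 1 / n) := by
    simp only [div_pow, div_eq_inv_mul ((histogram _ i : ℝ) ^ 2), iidExpectation_const_mul,
      iidExpectation_histogram_sq hP]
    have : ((n : ℝ) ^ 2)⁻¹ * (n * P i + n * (n - 1) * P i ^ 2) =
        P i * (P i + 1 / n) - P i ^ 2 / n := by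
      field_simp
      ring
    rw [this]
    have : 0 ≤ P i ^ 2 / n := by positivity
    linarith
  have hcs := sq_iidExpectation_mul_le (n := n) hP (fun x => √((histogram x i : ℝ) / n))
    (fun x => (histogram x i : ℝ) / n)
  simp only [Real.sq_sqrt (histogram_div_mem _ i).1, iidExpectation_frequency hn hP] at hcs
  have hle : iidExpectation P (fun x : Fin n → Fin k =>
      √((histogram x i : ℝ) / n) * ((histogram x i : ℝ) / n)) ^ 2 ≤
      (P i * √(P i) + P i / √n) ^ 2 := by
    refine hcs.trans ((mul_le_mul_of_nonneg_left h2 hp.1).trans ?_)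
    have e1 : √(P i) ^ 2 = P i := Real.sq_sqrt hp.1
    have e2 : √(n : ℝ) ^ 2 = n := Real.sq_sqrt hn0.le
    have : (P i * √(P i) + P i / √n) ^ 2 =
        P i * (P i * (P i + 1 / n)) + 2 * (P i * √(P i) * (P i / √n)) := by
      rw [add_sq, mul_pow, div_pow, e1, e2]
      ring
    rw [this]
    have := hp.1
    have : 0 ≤ 2 * (P i * √(P i) * (P i / √n)) := by positivity
    linarith
  have hnn : 0 ≤ P i * √(P i) + P i / √n := by
    have := hp.1
    positivity
  simpa only [mul_comm] using abs_le_of_sq_le_sq' hle hnn |>.2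

/-- The bias of the empirical frequency plugged into a function `f` with `|f''| ≤ A / √p`. -/
theorem abs_bias_le {f f₁ f₂ : ℝ → ℝ} {A : ℝ} (hA : 0 ≤ A) (hf : ContinuousOn f (Set.Icc 0 1))
    (h₁ : ∀ p ∈ Set.Ioo (0 : ℝ) 1, HasDerivAt f (f₁ p) p)
    (h₂ : ∀ p ∈ Set.Ioo (0 : ℝ) 1, HasDerivAt f₁ (f₂ p) p)
    (hb : ∀ p ∈ Set.Ioo (0 : ℝ) 1, |f₂ p| ≤ A / √p)
    (hn : 1 ≤ n) {P : Fin k → ℝ} (hP : P ∈ stdSimplex ℝ (Fin k)) (i : Fin k) :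
    |iidExpectation P (fun x : Fin n → Fin k => f ((histogram x i : ℝ) / n)) - f (P i)| ≤
      4 / 3 * A * (P i / √n) := by
  -- Jensen for `g + (4/3) A p √p` bounds `g(p) - E g` by the Jensen gap of the added term. Taking
  -- `g = f` and `g = -f` gives the two sides of the absolute value.
  have key : ∀ g g₁ g₂ : ℝ → ℝ, ContinuousOn g (Set.Icc 0 1) →
      (∀ p ∈ Set.Ioo (0 : ℝ) 1, HasDerivAt g (g₁ p) p) →
      (∀ p ∈ Set.Ioo (0 : ℝ) 1, HasDerivAt g₁ (g₂ p) p) →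
      (∀ p ∈ Set.Ioo (0 : ℝ) 1, |g₂ p| ≤ A / √p) →
      g (P i) - iidExpectation P (fun x : Fin n → Fin k => g ((histogram x i : ℝ) / n)) ≤
        4 / 3 * A * (P i / √n) := by
    intro g g₁ g₂ hg hg₁ hg₂ hgb
    have h := (convexOn_add_mul_sqrt hg hg₁ hg₂ hgb).le_iidExpectation_frequency hn hP i
    simp only [iidExpectation_add, iidExpectation_const_mul] at h
    have h' := mul_le_mul_of_nonneg_left (iidExpectation_mul_sqrt_le hn hP i)
      (show 0 ≤ 4 / 3 * A by positivity)
    rw [mul_add] at h'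
    linarith
  have ha := key f f₁ f₂ hf h₁ h₂ hb
  have hc := key (fun x => -f x) (fun x => -f₁ x) (fun x => -f₂ x) hf.neg
    (fun x hx => (h₁ x hx).neg) (fun x hx => (h₂ x hx).neg) (fun x hx => by simpa using hb x hx)
  have hneg : iidExpectation P (fun x : Fin n → Fin k => -f ((histogram x i : ℝ) / n)) =
      -iidExpectation P (fun x : Fin n → Fin k => f ((histogram x i : ℝ) / n)) := by
    simpa using iidExpectation_const_mul P (-1) (fun x : Fin n → Fin k =>
      f ((histogram x i : ℝ) / n))
  rw [hneg] at hc
  rw [abs_le]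
  constructor <;> linarith

/-- Bias–variance decomposition. -/
theorem quadraticRisk_eq (φ : ℝ → ℝ) (est : (Fin k → ℕ) → ℝ) {P : Fin k → ℝ}
    (hP : P ∈ stdSimplex ℝ (Fin k)) :
    quadraticRisk n φ est P =
      (iidExpectation P (fun x : Fin n → Fin k => est (histogram x) ^ 2) -
        iidExpectation P (fun x : Fin n → Fin k => est (histogram x)) ^ 2) +
      (iidExpectation P (fun x : Fin n → Fin k => est (histogram x)) -
        additiveFunctional φ P) ^ 2 := by
  have h : ∀ x : Fin n → Fin k, (est (histogram x) - additiveFunctional φ P) ^ 2 =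
      est (histogram x) ^ 2 - 2 * additiveFunctional φ P * est (histogram x) +
        additiveFunctional φ P ^ 2 := fun x => by ring
  simp only [quadraticRisk, h, iidExpectation_add, iidExpectation_sub, iidExpectation_const_mul,
    iidExpectation_const hP]
  ring

theorem abs_pluginEstimator_update_sub_le {φ : ℝ → ℝ} {L : ℝ} (hL : 0 ≤ L)
    (hφ : ∀ x ∈ Set.Icc (0 : ℝ) 1, ∀ y ∈ Set.Icc (0 : ℝ) 1, |φ x - φ y| ≤ L * |x - y|)
    (x : Fin n → Fin k) (j : Fin n) (a : Fin k) :
    |pluginEstimator n φ (histogram (Function.update x j a)) -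
      pluginEstimator n φ (histogram x)| ≤ 2 * L / n := by
  unfold pluginEstimator
  rw [← Finset.sum_sub_distrib]
  calc _ ≤ ∑ i, |φ ((histogram (Function.update x j a) i : ℝ) / n) -
        φ ((histogram x i : ℝ) / n)| := Finset.abs_sum_le_sum_abs _ _
    _ ≤ ∑ i, L / n * |(histogram (Function.update x j a) i : ℝ) - histogram x i| := by
        refine Finset.sum_le_sum fun i _ =>
          (hφ _ (histogram_div_mem _ i) _ (histogram_div_mem _ i)).trans (le_of_eq ?_)
        rw [← sub_div, abs_div, Nat.abs_cast]
        ring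
    _ ≤ L / n * 2 := by
        rw [← Finset.mul_sum]
        exact mul_le_mul_of_nonneg_left (sum_abs_histogram_update_sub_le x j a) (by positivity)
    _ = 2 * L / n := by ring

/-- The plugin estimator has quadratic risk `O(1 / n)`, uniformly in the alphabet size. -/
theorem HasDivergenceSpeed.exists_pluginRisk_le {α : ℝ} {φ : ℝ → ℝ}
    (h : HasDivergenceSpeed 2 α φ) (hα : 3 / 2 ≤ α) (hφ : ContinuousOn φ (Set.Icc 0 1)) :
    ∃ C : ℝ, 0 < C ∧ ∀ n k : ℕ, 1 ≤ n → ∀ P ∈ stdSimplex ℝ (Fin k),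
      quadraticRisk n φ (pluginEstimator n φ) P ≤ C / n := by
  obtain ⟨A, hA, hb⟩ := h.exists_abs_le hα
  obtain ⟨L, hL, hLip⟩ := exists_lipschitz_of_abs_deriv2_le hφ (fun p hp => h.hasDerivAt hp)
    (fun p hp => h.hasDerivAt_deriv hp) hb
  -- The variance contributes `n (2 L / n)²`, the squared bias `((4/3) A / √n)²`.
  refine ⟨4 * L ^ 2 + (4 / 3 * A) ^ 2, by positivity, fun n k hn P hP => ?_⟩
  have hn0 : (0 : ℝ) < n := by exact_mod_cast hn
  rw [quadraticRisk_eq φ _ hP, add_div]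
  refine add_le_add ?_ ?_
  · refine (iidExpectation_sq_sub_sq_le hP
      (fun x : Fin n → Fin k => pluginEstimator n φ (histogram x))
      (abs_pluginEstimator_update_sub_le hL.le hLip)).trans (le_of_eq ?_)
    field_simp
    ring
  · have hbias : |iidExpectation P (fun x : Fin n → Fin k => pluginEstimator n φ (histogram x)) -
        additiveFunctional φ P| ≤ 4 / 3 * A / √n := by
      simp only [pluginEstimator, additiveFunctional]
      rw [iidExpectation_sum, ← Finset.sum_sub_distrib]
      refine (Finset.abs_sum_le_sum_abs _ _).trans ((Finset.sum_le_sum fun i _ =>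
        abs_bias_le hA.le hφ (fun p hp => h.hasDerivAt hp) (fun p hp => h.hasDerivAt_deriv hp) hb
          hn hP i).trans (le_of_eq ?_))
      rw [← Finset.mul_sum, ← Finset.sum_div, hP.2]
      ring
    calc _ ≤ (4 / 3 * A / √n) ^ 2 := sq_le_sq' (abs_le.1 hbias).1 (abs_le.1 hbias).2
      _ = _ := by rw [div_pow (4 / 3 * A), Real.sq_sqrt hn0.le]

end UpperBound

/-! ### Le Cam's method along a segment -/

section LowerBound

variable {n k : ℕ}

/-- Change of measure: the expectation of `|f|` under `Q` is controlled by its second moment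
under `P` and the chi-square affinity. -/
theorem sq_iidExpectation_abs_le {P Q : Fin k → ℝ} (hP : P ∈ stdSimplex ℝ (Fin k))
    (hPQ : ∀ i, P i = 0 → Q i = 0) (f : (Fin n → Fin k) → ℝ) :
    iidExpectation Q (fun x => |f x|) ^ 2 ≤
      iidExpectation P (fun x => f x ^ 2) * (∑ i, Q i ^ 2 / P i) ^ n := by
  rw [← sum_prod_eq_pow]
  unfold iidExpectation
  refine Finset.sum_sq_le_sum_mul_sum_of_sq_le_mul _
    (fun x _ => mul_nonneg (prod_nonneg_of_mem_stdSimplex hP x) (sq_nonneg _))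
    (fun x _ => Finset.prod_nonneg fun j _ => div_nonneg (sq_nonneg _) (hP.1 _))
    (fun x _ => le_of_eq ?_)
  -- Absolute continuity is what saves this identity in the cells where the division is by zero.
  have h : ∀ i, P i * (Q i ^ 2 / P i) = Q i ^ 2 := by
    intro i
    by_cases h0 : P i = 0
    · simp [h0, hPQ i h0]
    · field_simp
  rw [mul_right_comm, ← Finset.prod_mul_distrib, mul_pow, sq_abs, ← Finset.prod_pow]
  simp only [h]

/-- Le Cam's two point method in chi-square form. -/
theorem abs_sub_le_of_quadraticRisk_le {φ : ℝ → ℝ} {est : (Fin k → ℕ) → ℝ} {P Q : Fin k → ℝ}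
    (hP : P ∈ stdSimplex ℝ (Fin k)) (hQ : Q ∈ stdSimplex ℝ (Fin k))
    (hPQ : ∀ i, P i = 0 → Q i = 0) {r K : ℝ} (hr : 0 ≤ r) (hK : 0 ≤ K)
    (h₁ : quadraticRisk n φ est P ≤ r) (h₂ : quadraticRisk n φ est Q ≤ r)
    (hχ : (∑ i, Q i ^ 2 / P i) ^ n ≤ K ^ 2) :
    |additiveFunctional φ Q - additiveFunctional φ P| ≤ (1 + K) * √r := by
  set a := additiveFunctional φ P
  set b := additiveFunctional φ Q
  -- Both errors are measured under `Q`: the distance to `a` through the change of measure from `P`,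
  -- the distance to `b` directly. The triangle inequality then joins them.
  have hp : iidExpectation Q (fun x : Fin n → Fin k => |est (histogram x) - a|) ≤ K * √r := by
    refine abs_le_of_sq_le_sq' ?_ (by positivity) |>.2
    refine (sq_iidExpectation_abs_le hP hPQ _).trans ?_
    rw [mul_pow, Real.sq_sqrt hr, mul_comm]
    exact mul_le_mul hχ h₁ (Finset.sum_nonneg fun x _ =>
      mul_nonneg (prod_nonneg_of_mem_stdSimplex hP x) (sq_nonneg _)) (sq_nonneg K)
  have hq : iidExpectation Q (fun x : Fin n → Fin k => |est (histogram x) - b|) ≤ √r := by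
    refine abs_le_of_sq_le_sq' ?_ (by positivity) |>.2
    have h := sq_iidExpectation_mul_le (n := n) hQ (fun x => |est (histogram x) - b|) fun _ => 1
    simp only [mul_one, sq_abs, iidExpectation_const hQ, one_pow] at h
    rw [Real.sq_sqrt hr]
    exact h.trans h₂
  have := iidExpectation_mono (n := n) hQ (f := fun _ => |b - a|)
    (g := fun x => |est (histogram x) - a| + |est (histogram x) - b|) fun x => by
      have := abs_sub_le b (est (histogram x)) a
      rw [abs_sub_comm b (est (histogram x))] at this
      linarith
  rw [iidExpectation_const hQ, iidExpectation_add] at this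
  linarith

/-- The segment between `P` and `Q`. -/
def segmentPoint (P Q : Fin k → ℝ) (t : ℝ) : Fin k → ℝ := fun i => (1 - t) * P i + t * Q i

theorem segmentPoint_mem {P Q : Fin k → ℝ} (hP : P ∈ stdSimplex ℝ (Fin k))
    (hQ : Q ∈ stdSimplex ℝ (Fin k)) {t : ℝ} (ht : t ∈ Set.Icc (0 : ℝ) 1) :
    segmentPoint P Q t ∈ stdSimplex ℝ (Fin k) :=
  convex_stdSimplex ℝ (Fin k) hP hQ (sub_nonneg.2 ht.2) ht.1 (by ring)

/-- Both weights are at least `δ`. Hence points of the trimmed segment share one support and have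
controlled likelihood ratios. -/
theorem mul_add_le_segmentPoint {P Q : Fin k → ℝ} (hP : P ∈ stdSimplex ℝ (Fin k))
    (hQ : Q ∈ stdSimplex ℝ (Fin k)) {δ t : ℝ} (ht : t ∈ Set.Icc δ (1 - δ)) (i : Fin k) :
    δ * (P i + Q i) ≤ segmentPoint P Q t i := by
  have h1 := mul_le_mul_of_nonneg_right (show δ ≤ 1 - t by linarith [ht.2]) (hP.1 i)
  have h2 := mul_le_mul_of_nonneg_right ht.1 (hQ.1 i)
  unfold segmentPoint
  linarith

theorem segmentPoint_eq_zero {P Q : Fin k → ℝ} (hP : P ∈ stdSimplex ℝ (Fin k))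
    (hQ : Q ∈ stdSimplex ℝ (Fin k)) {δ t : ℝ} (ht : t ∈ Set.Icc δ (1 - δ)) (hδ : 0 < δ)
    {i : Fin k} (h : segmentPoint P Q t i = 0) : P i = 0 ∧ Q i = 0 := by
  have h1 := mul_add_le_segmentPoint hP hQ ht i
  have hp := hP.1 i
  have hq := hQ.1 i
  rw [h] at h1
  have : P i + Q i ≤ 0 := by
    by_contra hc
    exact absurd h1 (not_le.2 (mul_pos hδ (not_le.1 hc)))
  constructor <;> linarith

/-- Expand around the point `y` at `t`: the linear term sums to zero, and `(Q - P)² ≤ (P + Q)² ≤ (P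
+ Q) y / δ` cellwise, where `P + Q` has total mass 2. -/
theorem sum_sq_div_segmentPoint_le {P Q : Fin k → ℝ} (hP : P ∈ stdSimplex ℝ (Fin k))
    (hQ : Q ∈ stdSimplex ℝ (Fin k)) {δ s t : ℝ} (ht : t ∈ Set.Icc δ (1 - δ)) (hδ : 0 < δ) :
    ∑ i, segmentPoint P Q s i ^ 2 / segmentPoint P Q t i ≤ 1 + 2 * (s - t) ^ 2 / δ := by
  have hterm : ∀ i, segmentPoint P Q s i ^ 2 / segmentPoint P Q t i ≤
      segmentPoint P Q t i + 2 * (s - t) * (Q i - P i) + (s - t) ^ 2 / δ * (P i + Q i) := by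
    intro i
    by_cases h0 : segmentPoint P Q t i = 0
    · obtain ⟨h1, h2⟩ := segmentPoint_eq_zero hP hQ ht hδ h0
      simp [h0, h1, h2]
    have hl := mul_add_le_segmentPoint hP hQ ht i
    have hp := hP.1 i
    have hq := hQ.1 i
    have hpos : 0 < segmentPoint P Q t i :=
      lt_of_le_of_ne ((by positivity : 0 ≤ δ * (P i + Q i)).trans hl) (Ne.symm h0)
    set y := segmentPoint P Q t i
    have hs : segmentPoint P Q s i = y + (s - t) * (Q i - P i) := by
      simp only [y, segmentPoint]; ring
    have hsq : (Q i - P i) ^ 2 ≤ (P i + Q i) / δ * y := by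
      have h1 : (Q i - P i) ^ 2 ≤ (P i + Q i) ^ 2 := by nlinarith [mul_nonneg hp hq]
      have h2 : (P i + Q i) / δ * (δ * (P i + Q i)) ≤ (P i + Q i) / δ * y :=
        mul_le_mul_of_nonneg_left hl (by positivity)
      have h3 : (P i + Q i) / δ * (δ * (P i + Q i)) = (P i + Q i) ^ 2 := by field_simp
      linarith
    rw [hs, div_le_iff₀ hpos]
    have h4 := mul_le_mul_of_nonneg_left hsq (sq_nonneg (s - t))
    calc (y + (s - t) * (Q i - P i)) ^ 2
        = y * y + 2 * (s - t) * (Q i - P i) * y + (s - t) ^ 2 * (Q i - P i) ^ 2 := by ring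
      _ ≤ y * y + 2 * (s - t) * (Q i - P i) * y + (s - t) ^ 2 * ((P i + Q i) / δ * y) := by
        linarith
      _ = _ := by ring
  refine (Finset.sum_le_sum fun i _ => hterm i).trans (le_of_eq ?_)
  simp only [segmentPoint, Finset.sum_add_distrib, ← Finset.mul_sum, Finset.sum_sub_distrib,
    hP.2, hQ.2]
  ring

theorem abs_sub_le_mul_of_steps (g : ℕ → ℝ) {D : ℝ} (m : ℕ)
    (h : ∀ l < m, |g (l + 1) - g l| ≤ D) : |g m - g 0| ≤ m * D := by
  rw [← Finset.sum_range_sub]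
  refine (Finset.abs_sum_le_sum_abs _ _).trans
    ((Finset.sum_le_sum fun l hl => h l (Finset.mem_range.1 hl)).trans (le_of_eq ?_))
  simp

/-- If the risk of an estimator is at most `r` along the segment from `P` to `Q`, then `r` is at
least of order `1 / n`. -/
theorem sq_sub_le_of_quadraticRisk_le {φ : ℝ → ℝ} {est : (Fin k → ℕ) → ℝ} {P Q : Fin k → ℝ}
    (hP : P ∈ stdSimplex ℝ (Fin k)) (hQ : Q ∈ stdSimplex ℝ (Fin k)) {δ r : ℝ} (hδ : 0 < δ)
    (hδ' : δ ≤ 1 / 2) (hr : 0 ≤ r) (hn : 1 ≤ n)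
    (h : ∀ R ∈ stdSimplex ℝ (Fin k), quadraticRisk n φ est R ≤ r) :
    (additiveFunctional φ (segmentPoint P Q (1 - δ)) -
      additiveFunctional φ (segmentPoint P Q δ)) ^ 2 ≤
      (2 * (1 + Real.exp (1 / δ))) ^ 2 * n * r := by
  -- The number of steps lies between `√n`, so that each squared step is at most `1 / n`, and `2
  -- √n`, so that summing the increments costs at most `4 n` after squaring.
  set m : ℕ := Nat.sqrt n + 1 with hm
  have hm0 : (0 : ℝ) < m := by positivity
  have hnm : (n : ℝ) ≤ m ^ 2 := by
    have := (Nat.sqrt_lt' (m := n) (n := m)).1 (by omega)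
    exact_mod_cast this.le
  have hmn : (m : ℝ) ^ 2 ≤ 4 * n := by
    have h1 : 1 ≤ Nat.sqrt n := Nat.le_sqrt.2 (by omega)
    have h2 : Nat.sqrt n ^ 2 ≤ n := Nat.sqrt_le' n
    have : m ^ 2 ≤ 4 * n := by nlinarith
    exact_mod_cast this
  set t : ℕ → ℝ := fun l => δ + l / m * (1 - 2 * δ) with ht
  have htmem : ∀ l ≤ m, t l ∈ Set.Icc δ (1 - δ) := by
    intro l hl
    have h1 : (0 : ℝ) ≤ l / m := by positivity
    have h2 : (l : ℝ) / m ≤ 1 := div_le_one_of_le₀ (by exact_mod_cast hl) hm0.le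
    simp only [ht]
    constructor <;> nlinarith
  have hsub : Set.Icc δ (1 - δ) ⊆ Set.Icc 0 1 := Set.Icc_subset_Icc hδ.le (by linarith)
  have hstep : ∀ l < m, |additiveFunctional φ (segmentPoint P Q (t (l + 1))) -
      additiveFunctional φ (segmentPoint P Q (t l))| ≤ (1 + Real.exp (1 / δ)) * √r := by
    intro l hl
    have hl0 := htmem l hl.le
    have hl1 := htmem (l + 1) hl
    have hs0 := segmentPoint_mem hP hQ (hsub hl0)
    have hs1 := segmentPoint_mem hP hQ (hsub hl1)
    refine abs_sub_le_of_quadraticRisk_le hs0 hs1 (fun i hi => ?_) hr (Real.exp_pos _).le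
      (h _ hs0) (h _ hs1) ?_
    · obtain ⟨h1, h2⟩ := segmentPoint_eq_zero hP hQ hl0 hδ hi
      simp [segmentPoint, h1, h2]
    · have hdiff : (t (l + 1) - t l) ^ 2 ≤ 1 / n := by
        have : t (l + 1) - t l = (1 - 2 * δ) / m := by
          simp only [ht]; push_cast; field_simp; ring
        rw [this, div_pow]
        exact div_le_div₀ zero_le_one (by nlinarith) (by positivity) hnm
      -- One sample has affinity at most `1 + 2 / (δ n)`, so `n` samples have at most `exp (2 / δ)`;
      -- hence `K = exp (1 / δ)`.
      calc _ ≤ (Real.exp (2 / δ / n)) ^ n := by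
            refine pow_le_pow_left₀ (Finset.sum_nonneg fun i _ =>
              div_nonneg (sq_nonneg _) (hs0.1 i)) ?_ n
            refine (sum_sq_div_segmentPoint_le hP hQ hl0 hδ).trans ?_
            have h1 := Real.add_one_le_exp (2 / δ / n)
            have h2 : 2 * (t (l + 1) - t l) ^ 2 / δ ≤ 2 / δ / n := by
              calc _ ≤ 2 * (1 / (n : ℝ)) / δ := by gcongr
                _ = _ := by ring
            linarith
        _ = Real.exp (1 / δ) ^ 2 := by
            have : (n : ℝ) ≠ 0 := by positivity
            rw [← Real.exp_nat_mul, ← Real.exp_nat_mul]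
            congr 1
            push_cast
            field_simp
  have htot := abs_sub_le_mul_of_steps
    (fun l => additiveFunctional φ (segmentPoint P Q (t l))) m hstep
  have ht0 : t 0 = δ := by simp [ht]
  have htm : t m = 1 - δ := by simp only [ht]; field_simp; ring
  simp only [ht0, htm] at htot
  calc _ ≤ (m * ((1 + Real.exp (1 / δ)) * √r)) ^ 2 :=
        sq_le_sq' (abs_le.1 htot).1 (abs_le.1 htot).2
    _ = (m : ℝ) ^ 2 * ((1 + Real.exp (1 / δ)) ^ 2 * r) := by
        rw [mul_pow, mul_pow, Real.sq_sqrt hr]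
    _ ≤ (4 * n) * ((1 + Real.exp (1 / δ)) ^ 2 * r) := by gcongr
    _ = _ := by ring

/-- If the values agreed for every small trimming, letting `δ → 0` would give equality at the
endpoints, by continuity. Trimming is needed because `P` and `Q` may have different supports. -/
theorem exists_segmentPoint_ne {φ : ℝ → ℝ} (hφ : ContinuousOn φ (Set.Icc 0 1))
    {P Q : Fin k → ℝ} (hP : P ∈ stdSimplex ℝ (Fin k)) (hQ : Q ∈ stdSimplex ℝ (Fin k))
    (hPQ : additiveFunctional φ P ≠ additiveFunctional φ Q) :
    ∃ δ : ℝ, 0 < δ ∧ δ ≤ 1 / 2 ∧ additiveFunctional φ (segmentPoint P Q (1 - δ)) ≠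
      additiveFunctional φ (segmentPoint P Q δ) := by
  have hcont : ContinuousOn (fun t => additiveFunctional φ (segmentPoint P Q t))
      (Set.Icc 0 1) := by
    unfold additiveFunctional
    refine continuousOn_finsetSum _ fun i _ => hφ.comp ?_ fun t ht =>
      mem_Icc_of_mem_stdSimplex (segmentPoint_mem hP hQ ht) i
    unfold segmentPoint
    fun_prop
  by_contra! hcon
  have hcont2 : ContinuousOn (fun t => additiveFunctional φ (segmentPoint P Q (1 - t)) -
      additiveFunctional φ (segmentPoint P Q t)) (Set.Icc 0 1) := by
    refine (hcont.comp (by fun_prop) fun t ht => ?_).sub hcont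
    exact ⟨by linarith [ht.2], by linarith [ht.1]⟩
  have h0 := (hcont2 0 (by simp)).mono_left
    (nhdsWithin_mono 0 (Set.Ioc_subset_Icc_self (a := (0 : ℝ)) (b := 1)))
  have hne : (nhdsWithin (0 : ℝ) (Set.Ioc 0 1)).NeBot := by
    rw [nhdsWithin_Ioc_eq_nhdsGT zero_lt_one]; infer_instance
  have hev : ∀ᶠ t in nhdsWithin (0 : ℝ) (Set.Ioc 0 1),
      additiveFunctional φ (segmentPoint P Q (1 - t)) -
      additiveFunctional φ (segmentPoint P Q t) = 0 := by
    rw [nhdsWithin_Ioc_eq_nhdsGT zero_lt_one]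
    filter_upwards [Ioc_mem_nhdsGT (show (0 : ℝ) < 1 / 2 by norm_num)] with t ht
    exact sub_eq_zero.2 (hcon t ht.1 ht.2)
  have hlim := tendsto_nhds_unique (h0.congr' hev) tendsto_const_nhds
  have e0 : segmentPoint P Q 0 = P := by ext; simp [segmentPoint]
  have e1 : segmentPoint P Q 1 = Q := by ext; simp [segmentPoint]
  simp only [sub_zero, e0, e1] at hlim
  exact hPQ (sub_eq_zero.1 hlim).symm

theorem append_zero_mem {P : Fin k → ℝ} (hP : P ∈ stdSimplex ℝ (Fin k)) (d : ℕ) :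
    (Fin.append P 0 : Fin (k + d) → ℝ) ∈ stdSimplex ℝ (Fin (k + d)) := by
  constructor
  · intro i
    refine Fin.addCases (fun j => ?_) (fun j => ?_) i
    · simpa using hP.1 j
    · simp
  · simp [Fin.sum_univ_add, hP.2]

/-- The shift does not depend on `P`, so differences of the functional survive padding. -/
theorem additiveFunctional_append_zero (φ : ℝ → ℝ) (P : Fin k → ℝ) (d : ℕ) :
    additiveFunctional φ (Fin.append P 0 : Fin (k + d) → ℝ) =
      additiveFunctional φ P + d * φ 0 := by
  simp [additiveFunctional, Fin.sum_univ_add]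

theorem segmentPoint_append_zero (P Q : Fin k → ℝ) (t : ℝ) (d : ℕ) :
    segmentPoint (Fin.append P 0 : Fin (k + d) → ℝ) (Fin.append Q 0) t =
      Fin.append (segmentPoint P Q t) 0 := by
  ext i
  refine Fin.addCases (fun j => ?_) (fun j => ?_) i <;> simp [segmentPoint]

theorem FunctionalNonconstant.mono {φ : ℝ → ℝ} {k l : ℕ} (h : FunctionalNonconstant k φ)
    (hkl : k ≤ l) : FunctionalNonconstant l φ := by
  obtain ⟨d, rfl⟩ := Nat.exists_eq_add_of_le hkl
  obtain ⟨P, hP, Q, hQ, hne⟩ := h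
  refine ⟨_, append_zero_mem hP d, _, append_zero_mem hQ d, ?_⟩
  simpa [additiveFunctional_append_zero] using hne

/-- The risk is bounded below by `c / n`, uniformly in the alphabet size. -/
theorem exists_le_minimaxRisk {φ : ℝ → ℝ} (hφ : ContinuousOn φ (Set.Icc 0 1)) :
    ∃ c : ℝ, 0 < c ∧ ∀ n k : ℕ, 1 ≤ n → FunctionalNonconstant k φ →
      ENNReal.ofReal (c / n) ≤ minimaxRisk n k φ := by
  classical
  -- The segment is fixed once, in the least alphabet with a nonconstant functional, so `G` and `δ`
  -- do not depend on `k`. If there is no such alphabet, any constant works.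
  by_cases hex : ∃ k, FunctionalNonconstant k φ
  swap
  · exact ⟨1, one_pos, fun n k _ h => absurd ⟨k, h⟩ hex⟩
  obtain ⟨P, hP, Q, hQ, hne⟩ := Nat.find_spec hex
  obtain ⟨δ, hδ, hδ', hne'⟩ := exists_segmentPoint_ne hφ hP hQ hne
  set G := additiveFunctional φ (segmentPoint P Q (1 - δ)) -
    additiveFunctional φ (segmentPoint P Q δ) with hG
  set B := (2 * (1 + Real.exp (1 / δ))) ^ 2 with hB
  have hBpos : 0 < B := by positivity
  have hGpos : 0 < G ^ 2 := by
    have : G ≠ 0 := sub_ne_zero.2 hne'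
    positivity
  -- The factor 2 yields the contradiction `G² ≤ G² / 2` if the risk stays below the threshold
  -- everywhere.
  refine ⟨G ^ 2 / (2 * B), by positivity, fun n k hn hk => le_iInf fun est => ?_⟩
  have hn0 : (0 : ℝ) < n := by exact_mod_cast hn
  obtain ⟨d, rfl⟩ := Nat.exists_eq_add_of_le (Nat.find_min' hex hk)
  obtain ⟨R, hR, hle⟩ : ∃ R ∈ stdSimplex ℝ (Fin (Nat.find hex + d)),
      G ^ 2 / (2 * B) / n ≤ quadraticRisk n φ est R := by
    by_contra! hcon
    have h := sq_sub_le_of_quadraticRisk_le (append_zero_mem hP d) (append_zero_mem hQ d) hδ hδ'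
      (by positivity : 0 ≤ G ^ 2 / (2 * B) / n) hn fun R hR => (hcon R hR).le
    rw [segmentPoint_append_zero, segmentPoint_append_zero, additiveFunctional_append_zero,
      additiveFunctional_append_zero, add_sub_add_right_eq_sub, ← hG, ← hB] at h
    have : B * n * (G ^ 2 / (2 * B) / n) = G ^ 2 / 2 := by field_simp
    linarith
  exact (ENNReal.ofReal_le_ofReal hle).trans
    (le_iSup₂_of_le (f := fun P _ => ENNReal.ofReal (quadraticRisk n φ est P)) R hR le_rfl)

end LowerBound

/-! ### When the functional is nonconstant -/

section Nonconstant

/-- Constancy makes `φ(p) + φ(1 - p)` constant, so `φ''(p) = -φ''(1 - p)`. As `p → 0` the right side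
stays bounded, while the lower speed bound forces the left side to blow up when `α < 2`. -/
theorem functionalNonconstant_two {α : ℝ} {φ : ℝ → ℝ} (h : HasDivergenceSpeed 2 α φ)
    (hα : α < 2) : FunctionalNonconstant 2 φ := by
  by_contra hcon
  have hconst : ∀ p ∈ Set.Icc (0 : ℝ) 1, φ p + φ (1 - p) = φ 0 + φ 1 := by
    intro p hp
    by_contra hne
    refine hcon ⟨![p, 1 - p], ⟨?_, by simp⟩, ![0, 1], ⟨?_, by simp⟩, ?_⟩
    · intro i
      fin_cases i
      · simpa using hp.1
      · simpa using hp.2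
    · intro i
      fin_cases i <;> simp
    · simpa [additiveFunctional] using hne
  have hrefl : ∀ p ∈ Set.Ioo (0 : ℝ) 1, 1 - p ∈ Set.Ioo (0 : ℝ) 1 := fun p hp =>
    ⟨by linarith [hp.2], by linarith [hp.1]⟩
  have hd1 : ∀ p ∈ Set.Ioo (0 : ℝ) 1, deriv φ p = deriv φ (1 - p) := by
    intro p hp
    have h1 : HasDerivAt (fun x => φ x + φ (1 - x)) (deriv φ p + deriv φ (1 - p) * (-1)) p :=
      (h.hasDerivAt hp).add ((h.hasDerivAt (hrefl p hp)).comp p ((hasDerivAt_id p).const_sub 1))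
    have h2 : HasDerivAt (fun x => φ x + φ (1 - x)) 0 p := by
      refine (hasDerivAt_const p (φ 0 + φ 1)).congr_of_eventuallyEq ?_
      filter_upwards [isOpen_Ioo.mem_nhds hp] with q hq
      exact hconst q (Set.Ioo_subset_Icc_self hq)
    linarith [h1.unique h2]
  have hd2 : ∀ p ∈ Set.Ioo (0 : ℝ) 1, iteratedDeriv 2 φ p = -iteratedDeriv 2 φ (1 - p) := by
    intro p hp
    have h1 : HasDerivAt (fun x => deriv φ (1 - x)) (iteratedDeriv 2 φ (1 - p) * (-1)) p :=
      (h.hasDerivAt_deriv (hrefl p hp)).comp p ((hasDerivAt_id p).const_sub 1)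
    have h2 : HasDerivAt (fun x => deriv φ (1 - x)) (iteratedDeriv 2 φ p) p := by
      refine (h.hasDerivAt_deriv hp).congr_of_eventuallyEq ?_
      filter_upwards [isOpen_Ioo.mem_nhds hp] with q hq
      exact (hd1 q hq).symm
    linarith [h1.unique h2]
  obtain ⟨-, W, c, c', hW, -, -, hb⟩ := h
  set e : ℝ := -((2 : ℕ) : ℝ) + α with he
  have he0 : e < 0 := by simp only [he]; push_cast; linarith
  set B := (W * (1 / 2) ^ e + c + c') / W with hB
  have hbd : ∀ p ∈ Set.Ioo (0 : ℝ) (1 / 2), p ^ e ≤ B := by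
    intro p hp
    have hp1 : p ∈ Set.Ioo (0 : ℝ) 1 := ⟨hp.1, by linarith [hp.2]⟩
    have h1 := (hb p hp1).1
    have h2 := (hb _ (hrefl p hp1)).2
    rw [hd2 p hp1, abs_neg] at h1
    have h3 : (1 - p) ^ e ≤ (1 / 2) ^ e :=
      Real.rpow_le_rpow_of_nonpos (by norm_num) (by linarith [hp.2]) he0.le
    have h4 := mul_le_mul_of_nonneg_left h3 hW.le
    rw [hB, le_div_iff₀ hW]
    linarith
  have htend := tendsto_rpow_neg_nhdsGT_zero he0
  obtain ⟨p, hp1, hp2⟩ := ((htend.eventually_gt_atTop B).and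
    (Ioo_mem_nhdsGT (show (0 : ℝ) < 1 / 2 by norm_num))).exists
  exact absurd (hbd p hp2) (not_le.2 hp1)

/-- Comparing `(p, q, 1 - p - q)` with `(p + q, 0, 1 - p - q)`, constancy gives Cauchy's equation
for `φ - φ(0)`. Differentiating in `p` shows that `φ'` is constant on `(0, 1)`, and continuity
carries affinity to the endpoints. -/
theorem functionalNonconstant_three {α : ℝ} {φ : ℝ → ℝ} (h : HasDivergenceSpeed 2 α φ)
    (hφ : ContinuousOn φ (Set.Icc 0 1)) (haff : ¬ AffineOnUnitInterval φ) :
    FunctionalNonconstant 3 φ := by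
  by_contra hcon
  apply haff
  have hconst : ∀ p q : ℝ, 0 ≤ p → 0 ≤ q → p + q ≤ 1 →
      φ p + φ q + φ (1 - p - q) = φ 0 + φ 0 + φ 1 := by
    intro p q hp hq hpq
    by_contra hne
    refine hcon ⟨![p, q, 1 - p - q], ⟨?_, ?_⟩, ![0, 0, 1], ⟨?_, ?_⟩, ?_⟩
    · intro i
      fin_cases i
      · simpa using hp
      · simpa using hq
      · simp; linarith
    · simp [Fin.sum_univ_three]
    · intro i
      fin_cases i <;> simp
    · simp [Fin.sum_univ_three]
    · simpa [additiveFunctional, Fin.sum_univ_three] using hne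
  have hadd : ∀ p q : ℝ, 0 ≤ p → 0 ≤ q → p + q ≤ 1 → φ (p + q) = φ p + φ q - φ 0 := by
    intro p q hp hq hpq
    have h1 := hconst p q hp hq hpq
    have h2 := hconst (p + q) 0 (by linarith) le_rfl (by linarith)
    rw [show 1 - (p + q) - 0 = 1 - p - q by ring] at h2
    linarith
  have hlt : ∀ p ∈ Set.Ioo (0 : ℝ) 1, ∀ r ∈ Set.Ioo (0 : ℝ) 1, p < r →
      deriv φ r = deriv φ p := by
    intro p hp r hr hpr
    have h1 : HasDerivAt (fun x => φ (x + (r - p))) (deriv φ r) p := by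
      have : HasDerivAt φ (deriv φ r) (p + (r - p)) := by
        rw [add_sub_cancel]; exact h.hasDerivAt hr
      exact this.comp_add_const p (r - p)
    have h2 : HasDerivAt (fun x => φ (x + (r - p))) (deriv φ p) p := by
      refine (((h.hasDerivAt hp).add_const (φ (r - p))).sub_const (φ 0)).congr_of_eventuallyEq ?_
      filter_upwards [Ioo_mem_nhds hp.1 (show p < 1 - (r - p) by linarith [hr.2])] with x hx
      exact hadd x (r - p) hx.1.le (by linarith) (by linarith [hx.2])
    exact h1.unique h2
  have hm : (1 / 2 : ℝ) ∈ Set.Ioo (0 : ℝ) 1 := by norm_num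
  set b := deriv φ (1 / 2) with hb
  have hder : ∀ p ∈ Set.Ioo (0 : ℝ) 1, HasDerivAt φ b p := by
    intro p hp
    have : deriv φ p = b := by
      rcases lt_trichotomy p (1 / 2) with h' | h' | h'
      · exact (hlt p hp _ hm h').symm
      · rw [h']
      · exact hlt _ hm p hp h'
    exact this ▸ h.hasDerivAt hp
  refine ⟨φ 0, b, fun p hp => ?_⟩
  rcases hp.1.eq_or_lt with h0 | h0
  · simp [← h0]
  obtain ⟨c, hc, hce⟩ := exists_hasDerivAt_eq_slope φ (fun _ => b) h0
    (hφ.mono (Set.Icc_subset_Icc_right hp.2)) fun z hz => hder z ⟨hz.1, hz.2.trans_le hp.2⟩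
  rw [hce]
  field_simp
  ring

end Nonconstant

theorem mainTheorem5 (α : ℝ) (hα : α ∈ Set.Icc (3 / 2 : ℝ) 2) (φ : ℝ → ℝ)
    (hφ : ContinuousOn φ (Set.Icc 0 1)) (hspeed : HasDivergenceSpeed 2 α φ) :
    (∃ c C : ℝ, 0 < c ∧ 0 < C ∧ ∀ n k : ℕ, 1 ≤ n → 1 ≤ k →
      (FunctionalNonconstant k φ → ENNReal.ofReal (c / n) ≤ minimaxRisk n k φ) ∧
      minimaxRisk n k φ ≤ ENNReal.ofReal (C / n) ∧
      worstCaseRisk n k φ (pluginEstimator n φ) ≤ ENNReal.ofReal (C / n)) ∧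
    (α < 2 → ∀ k : ℕ, 2 ≤ k → FunctionalNonconstant k φ) ∧
    (¬ AffineOnUnitInterval φ → ∀ k : ℕ, 3 ≤ k → FunctionalNonconstant k φ) := by
  obtain ⟨c, hc, hlow⟩ := exists_le_minimaxRisk hφ
  obtain ⟨C, hC, hup⟩ := hspeed.exists_pluginRisk_le hα.1 hφ
  refine ⟨⟨c, C, hc, hC, fun n k hn _ => ?_⟩,
    fun hα2 k hk => (functionalNonconstant_two hspeed hα2).mono hk,
    fun haff k hk => (functionalNonconstant_three hspeed hφ haff).mono hk⟩
  have hplug : worstCaseRisk n k φ (pluginEstimator n φ) ≤ ENNReal.ofReal (C / n) :=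
    iSup₂_le fun P hP => ENNReal.ofReal_le_ofReal (hup n k hn P hP)
  exact ⟨hlow n k hn, (iInf_le _ _).trans hplug, hplug⟩
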